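/- Let $p$ be a polynomial with complex coefficients and $\deg p\ge 2$, and let $P(M)=p(M)$ be the corresponding map on $\mathcal M(2,\mathbb C)$, the space of complex $2\times2$ matrices. Write $f^r$ for the $r$-th iterate of a map $f$, and put $$K_p=\{z\in\mathbb C:\{p^r(z)\}_{r\ge1}\text{ is bounded}\},\qquad J_p=\partial K_p,\qquad K_P=\{M\in\mathcal M(2,\mathbb C):\{P^r(M)\}_{r\ge1}\text{ is bounded}\}.$$ The Fatou set of $P$ is the set of all $M$ having an open neighbourhood $U$ on which $\{P^n\}_{n\ge1}$ is a normal family, that is, every sequence in the family has a subsequence that either converges locally uniformly on $U$ to a holomorphic map or diverges to infinity uniformly on compact subsets of $U$; the Julia set $J_P$ is the complement of the Fatou set. Then $$J_P=\partial\,\overline{K_P}=\left\{Q\begin{pmatrix}\lambda_1&0\\0&\lambda_2\end{pmatrix}Q^{-1}:(\lambda_1,\lambda_2)\in(K_p\times J_p)\cup(J_p\times K_p),\ Q\in \mathrm{GL}(2,\mathbb C)\right\}\cup\left\{Q\begin{pmatrix}\lambda&1\\0&\lambda\end{pmatrix}Q^{-1}:\lambda\in J_p,\ Q\in \mathrm{GL}(2,\mathbb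 C)\right\}.$$ -/

import Mathlib

open Polynomial Matrix Filter Set

-- The entrywise sup norm on matrices; all norms on `M(2, ℂ)` are equivalent, so the notions below
-- (boundedness, topology, locally uniform convergence, holomorphy) do not depend on this choice.
attribute [local instance] Matrix.normedAddCommGroup Matrix.normedSpace

/-- The sequence `u` diverges uniformly to infinity on compact subsets of `U`: for all compact
`K ⊆ U` and every bound `R`, eventually `‖u n x‖ > R` for all `x ∈ K`. -/
def DivergesLocallyUniformlyOn {E F : Type*} [NormedAddCommGroup E] [NormedAddCommGroup F]
    (u : ℕ → E → F) (U : Set E) : Prop :=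
  ∀ K ⊆ U, IsCompact K → ∀ R : ℝ, ∀ᶠ n in atTop, ∀ x ∈ K, R < ‖u n x‖

/-- A family `𝓕` of maps is normal on `U` if each sequence in `𝓕` has a subsequence that either
converges locally uniformly on `U` to a holomorphic map or diverges locally uniformly on `U` to
infinity. -/
def IsNormalFamilyOn {E F : Type*} [NormedAddCommGroup E] [NormedSpace ℂ E]
    [NormedAddCommGroup F] [NormedSpace ℂ F] (𝓕 : Set (E → F)) (U : Set E) : Prop :=
  ∀ u : ℕ → E → F, (∀ n, u n ∈ 𝓕) → ∃ φ : ℕ → ℕ, StrictMono φ ∧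
    ((∃ g : E → F, DifferentiableOn ℂ g U ∧
        TendstoLocallyUniformlyOn (fun n => u (φ n)) g atTop U) ∨
      DivergesLocallyUniformlyOn (fun n => u (φ n)) U)

/-- The Fatou set of a self-map: the points with an open neighbourhood on which the iterates
`f^n`, `n ≥ 1`, form a normal family. -/
def fatouSet {E : Type*} [NormedAddCommGroup E] [NormedSpace ℂ E] (f : E → E) : Set E :=
  {x | ∃ U : Set E, IsOpen U ∧ x ∈ U ∧ IsNormalFamilyOn {h | ∃ n : ℕ, 1 ≤ n ∧ h = f^[n]} U}

/-- The Julia set of a self-map: the complement of the Fatou set. -/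
def juliaSet {E : Type*} [NormedAddCommGroup E] [NormedSpace ℂ E] (f : E → E) : Set E :=
  (fatouSet f)ᶜ

/-- The points `x` whose orbit `{f^r(x)}`, `r ≥ 1`, is bounded. -/
def boundedOrbitSet {E : Type*} [NormedAddCommGroup E] (f : E → E) : Set E :=
  {x | Bornology.IsBounded {y | ∃ r : ℕ, 1 ≤ r ∧ y = f^[r] x}}

/-- The filled Julia set `K_p` of a complex polynomial. -/
def filledJulia (p : ℂ[X]) : Set ℂ :=
  boundedOrbitSet fun z => p.eval z

/-- The Julia set `J_p = ∂ K_p` of a complex polynomial. -/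
def polyJulia (p : ℂ[X]) : Set ℂ :=
  frontier (filledJulia p)

/-- The matrix-valued polynomial `P(M) = a_k M^k + ⋯ + a_1 M + a_0 I` on `M(2, ℂ)`. -/
noncomputable def matrixPoly (p : ℂ[X]) (M : Matrix (Fin 2) (Fin 2) ℂ) :
    Matrix (Fin 2) (Fin 2) ℂ :=
  aeval M p

/-! The dynamics of $P$ is governed by eigenvalues: if $M$ has eigenvalues $a,b$, then $P^n(M)$ has
eigenvalues $p^n(a),p^n(b)$. Let $S$ (`spectralFilledJulia`) be the set of matrices with both
eigenvalues in $K_p$. Both $\overline{K_P}=S$ and $J_P=\partial S$ hold, and the Jordan normal form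
turns $\partial S$ into the explicit union.

The quantitative tool is the Newton form $f(M)=f(a)I+q(b)(M-aI)$, with $q$ the divided difference of
$f$ at $a$. It bounds $P^n(M)$ uniformly in $n$ when $a,b\in K_p$ are separated, or when $K_p$
contains a circle of fixed radius about $a$ (`norm_aeval_le`). A double eigenvalue in $J_p$ may have
an unbounded orbit, as $(p^n)'(a)$ enters; this is why the closure of $K_P$ appears. Such a matrix
is still a limit of matrices with distinct eigenvalues in $K_p$, because $K_p$ has no isolated
points (`exists_ne_mem_filledJulia`).

Off $S$ an eigenvalue escapes locally uniformly, so the iterates diverge. Inside $S$ they are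
locally bounded, so Montel's theorem applies. Near a point of $\partial S$ there are both bounded
and escaping orbits, which excludes normality. -/

/-! ### Holomorphic limits and Montel's theorem -/

open Metric Topology in
/-- A uniform limit of holomorphic maps between complex normed spaces is holomorphic. -/
theorem differentiableOn_of_tendstoUniformlyOn {E F : Type*} [NormedAddCommGroup E]
    [NormedSpace ℂ E] [NormedAddCommGroup F] [NormedSpace ℂ F] [CompleteSpace F]
    {u : ℕ → E → F} {g : E → F} {U : Set E} (hU : IsOpen U)
    (hu : ∀ n, DifferentiableOn ℂ (u n) U) (h : TendstoUniformlyOn u g atTop U) :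
    DifferentiableOn ℂ g U := by
  intro x hx
  suffices H : ∃ g' : E → E →L[ℂ] F, HasFDerivAt g (g' x) x from
    H.choose_spec.differentiableAt.differentiableWithinAt
  obtain ⟨ρ, hρ, hρU⟩ := Metric.isOpen_iff.1 hU x hx
  obtain ⟨r, rfl⟩ : ∃ r, ρ = 2 * r := ⟨ρ / 2, by ring⟩
  have hr : 0 < r := by linarith
  have hunif := h.mono hρU
  have hsub : ball x r ⊆ ball x (2 * r) := ball_subset_ball (by linarith)
  -- Cauchy estimates on balls of radius `r` make the derivatives uniformly Cauchy: functions within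
  -- `ε * r / 4` of each other have a difference oscillating by at most `ε * r / 2`.
  have hcau : UniformCauchySeqOn (fun n => fderiv ℂ (u n)) atTop (ball x r) := by
    rw [Metric.uniformCauchySeqOn_iff]
    intro ε hε
    have hc := hunif.uniformCauchySeqOn
    rw [Metric.uniformCauchySeqOn_iff] at hc
    obtain ⟨N, hN⟩ := hc (ε * r / 4) (by positivity)
    refine ⟨N, fun m hm n hn y hy => ?_⟩
    have hball : ball y r ⊆ ball x (2 * r) := by
      apply ball_subset_ball'
      rw [mem_ball] at hy
      linarith
    have hy2 : y ∈ ball x (2 * r) := hsub hy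
    have hdm : ∀ n, DifferentiableAt ℂ (u n) y := fun n =>
      (hu n).differentiableAt (hU.mem_nhds (hρU hy2))
    rw [dist_eq_norm, ← fderiv_sub (hdm m) (hdm n)]
    have hle : ‖fderiv ℂ (u m - u n) y‖ ≤ (ε * r / 2) / r := by
      apply Complex.norm_fderiv_le_div_of_mapsTo_ball _ _ hr
      · exact ((hu m).sub (hu n)).mono (hball.trans hρU)
      · intro z hz
        rw [mem_closedBall, dist_eq_norm]
        have h1 := hN m hm n hn z (hball hz)
        have h2 := hN m hm n hn y hy2
        rw [dist_eq_norm] at h1 h2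
        calc ‖(u m - u n) z - (u m - u n) y‖ ≤ ‖(u m - u n) z‖ + ‖(u m - u n) y‖ := norm_sub_le _ _
          _ ≤ ε * r / 2 := by simp only [Pi.sub_apply]; linarith
    calc _ ≤ (ε * r / 2) / r := hle
      _ = ε / 2 := by field_simp
      _ < ε := by linarith
  have hlim : ∀ y, ∃ L : E →L[ℂ] F, y ∈ ball x r →
      Tendsto (fun n => fderiv ℂ (u n) y) atTop (𝓝 L) := by
    intro y
    by_cases hy : y ∈ ball x r
    · obtain ⟨L, hL⟩ := cauchySeq_tendsto_of_complete (hcau.cauchySeq hy)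
      exact ⟨L, fun _ => hL⟩
    · exact ⟨0, fun h => absurd h hy⟩
  choose g' hg' using hlim
  refine ⟨g', hasFDerivAt_of_tendstoUniformlyOn isOpen_ball
    (hcau.tendstoUniformlyOn_of_tendsto hg') (fun n y hy => ?_)
    (fun y hy => hunif.tendsto_at (hsub hy)) (mem_ball_self hr)⟩
  exact ((hu n).differentiableAt (hU.mem_nhds (hρU (hsub hy)))).hasFDerivAt

open Metric Topology in
/-- The Montel theorem on a ball: a sequence of holomorphic maps which is bounded on a ball has a
subsequence that converges uniformly on the concentric ball of one third of the radius. -/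
theorem exists_subseq_tendstoUniformlyOn_of_bounded {E F : Type*} [NormedAddCommGroup E]
    [NormedSpace ℂ E] [ProperSpace E] [NormedAddCommGroup F] [NormedSpace ℂ F] [ProperSpace F]
    {u : ℕ → E → F} {x : E} {r C : ℝ} (hr : 0 < r)
    (hu : ∀ n, DifferentiableOn ℂ (u n) (ball x (3 * r)))
    (hC : ∀ n, ∀ y ∈ ball x (3 * r), ‖u n y‖ ≤ C) :
    ∃ φ : ℕ → ℕ, StrictMono φ ∧ ∃ g : E → F, DifferentiableOn ℂ g (ball x r) ∧
      TendstoUniformlyOn (fun n => u (φ n)) g atTop (ball x r) := by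
  have hsub : closedBall x r ⊆ ball x (3 * r) := closedBall_subset_ball (by linarith)
  have hC0 : 0 ≤ C := (norm_nonneg _).trans (hC 0 x (mem_ball_self (by linarith)))
  -- A common Lipschitz constant from the Cauchy estimate supplies the equicontinuity for
  -- Arzelà–Ascoli.
  have hlip : ∀ n, ∀ y ∈ closedBall x r, ∀ z ∈ closedBall x r,
      ‖u n z - u n y‖ ≤ 2 * C / r * ‖z - y‖ := by
    intro n y hy z hz
    refine (convex_closedBall x r).norm_image_sub_le_of_norm_fderiv_le (𝕜 := ℂ)
      (fun w hw => (hu n).differentiableAt (isOpen_ball.mem_nhds (hsub hw))) (fun w hw => ?_) hy hz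
    have hball : ball w r ⊆ ball x (3 * r) := by
      apply ball_subset_ball'
      rw [mem_closedBall] at hw
      linarith
    refine Complex.norm_fderiv_le_div_of_mapsTo_ball ((hu n).mono hball) (fun v hv => ?_) hr
    rw [mem_closedBall, dist_eq_norm]
    linarith [norm_sub_le (u n v) (u n w), hC n v (hball hv), hC n w (hsub hw)]
  have hcs : CompactSpace (closedBall x r) :=
    isCompact_iff_compactSpace.1 (isCompact_closedBall x r)
  let v : ℕ → BoundedContinuousFunction (closedBall x r) F := fun n =>
    BoundedContinuousFunction.mkOfCompact
      ⟨fun y => u n y, ((hu n).continuousOn.mono hsub).domRestrict⟩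
  have hcomp : IsCompact (closure (range v)) := by
    refine BoundedContinuousFunction.arzela_ascoli (closedBall 0 C) (isCompact_closedBall 0 C) _
      ?_ ?_
    · rintro f y ⟨n, rfl⟩
      exact mem_closedBall_zero_iff.2 (hC n y (hsub y.2))
    · refine Metric.equicontinuous_of_continuity_modulus (fun t => 2 * C / r * t) ?_ _ ?_
      · have : Tendsto (fun t : ℝ => 2 * C / r * t) (𝓝 0) (𝓝 (2 * C / r * 0)) :=
          tendsto_id.const_mul _
        simpa using this
      · rintro y z ⟨f, n, rfl⟩
        have := hlip n z z.2 y y.2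
        rw [← dist_eq_norm, ← dist_eq_norm] at this
        exact this
  obtain ⟨G, -, φ, hφ, hG⟩ := hcomp.tendsto_subseq
    (fun n => subset_closure (mem_range_self n) : ∀ n, v n ∈ closure (range v))
  classical
  let g : E → F := fun y => if h : y ∈ closedBall x r then G ⟨y, h⟩ else 0
  have hunif : TendstoUniformlyOn (fun n => u (φ n)) g atTop (ball x r) := by
    have h1 := BoundedContinuousFunction.tendsto_iff_tendstoUniformly.1 hG
    rw [Metric.tendstoUniformly_iff] at h1
    rw [Metric.tendstoUniformlyOn_iff]
    intro ε hε
    filter_upwards [h1 ε hε] with n hn y hy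
    have hy' := ball_subset_closedBall hy
    simp only [g, dif_pos hy']
    exact hn ⟨y, hy'⟩
  refine ⟨φ, hφ, g, ?_, hunif⟩
  exact differentiableOn_of_tendstoUniformlyOn isOpen_ball
    (fun n => (hu (φ n)).mono (ball_subset_closedBall.trans hsub)) hunif

/-! ### Escape to infinity and the filled Julia set in the plane -/

/-- In $p(z)=z\,g(z)+p(0)$ the factor $g$ is nonconstant, so far out $|g|\ge 3$ and $|p(0)|\le|z|$.
-/
theorem exists_escape_radius (p : ℂ[X]) (hp : 2 ≤ p.natDegree) :
    ∃ R : ℝ, 0 < R ∧ ∀ z : ℂ, R < ‖z‖ → 2 * ‖z‖ ≤ ‖p.eval z‖ := by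
  have hq : 0 < p.divX.degree := by
    rw [← natDegree_pos_iff_degree_pos, natDegree_divX_eq_natDegree_tsub_one]
    omega
  have hlim := p.divX.tendsto_norm_atTop hq (tendsto_norm_cobounded_atTop (E := ℂ))
  have h3 := hlim.eventually_ge_atTop 3
  rw [← comap_norm_atTop, eventually_comap] at h3
  obtain ⟨R, hR⟩ := eventually_atTop.1 h3
  refine ⟨max (max R 1) ‖p.coeff 0‖, by positivity, fun z hz => ?_⟩
  have h1 : R ≤ ‖z‖ := ((le_max_left _ _).trans (le_max_left _ _)).trans hz.le
  have h2 : ‖p.coeff 0‖ ≤ ‖z‖ := (le_max_right _ _).trans hz.le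
  have h4 := hR _ h1 z rfl
  have h5 : p.eval z = p.divX.eval z * z + p.coeff 0 := by
    conv_lhs => rw [← divX_mul_X_add p]
    simp
  have h6 : ‖p.divX.eval z * z‖ ≤ ‖p.eval z‖ + ‖p.coeff 0‖ := by
    rw [h5]
    simpa using norm_sub_le (p.divX.eval z * z + p.coeff 0) (p.coeff 0)
  rw [norm_mul] at h6
  nlinarith [norm_nonneg z]

theorem pow_mul_norm_le_norm_iterate {f : ℂ → ℂ} {R : ℝ} (hf : ∀ z, R < ‖z‖ → 2 * ‖z‖ ≤ ‖f z‖)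
    {z : ℂ} (hz : R < ‖z‖) (n : ℕ) : 2 ^ n * ‖z‖ ≤ ‖f^[n] z‖ := by
  induction n generalizing z with
  | zero => simp
  | succ n ih =>
    have h := hf z hz
    have h1 := ih (z := f z) (by linarith [norm_nonneg z])
    rw [Function.iterate_succ_apply, pow_succ]
    have : (0 : ℝ) < 2 ^ n := by positivity
    nlinarith

/-- Adding the starting point `n = 0` to the orbit does not affect boundedness. -/
theorem mem_boundedOrbitSet_iff {E : Type*} [NormedAddCommGroup E] {f : E → E} {x : E} :
    x ∈ boundedOrbitSet f ↔ ∃ C : ℝ, ∀ n : ℕ, ‖f^[n] x‖ ≤ C := by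
  simp only [boundedOrbitSet, mem_ofPred_eq, isBounded_iff_forall_norm_le]
  constructor
  · rintro ⟨C, hC⟩
    refine ⟨max C ‖x‖, fun n => ?_⟩
    rcases Nat.eq_zero_or_pos n with rfl | hn
    · simp
    · exact (hC _ ⟨n, hn, rfl⟩).trans (le_max_left _ _)
  · rintro ⟨C, hC⟩
    refine ⟨C, ?_⟩
    rintro y ⟨n, -, rfl⟩
    exact hC n

theorem map_mem_boundedOrbitSet_iff {E : Type*} [NormedAddCommGroup E] {f : E → E} {x : E} :
    f x ∈ boundedOrbitSet f ↔ x ∈ boundedOrbitSet f := by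
  simp only [mem_boundedOrbitSet_iff, ← Function.iterate_succ_apply]
  constructor
  · rintro ⟨C, hC⟩
    refine ⟨max C ‖x‖, fun n => ?_⟩
    cases n with
    | zero => simp
    | succ n => exact (hC n).trans (le_max_left _ _)
  · rintro ⟨C, hC⟩
    exact ⟨C, fun n => hC _⟩

theorem iterate_mem_boundedOrbitSet_iff {E : Type*} [NormedAddCommGroup E] {f : E → E} {x : E}
    (n : ℕ) : f^[n] x ∈ boundedOrbitSet f ↔ x ∈ boundedOrbitSet f := by
  induction n with
  | zero => simp
  | succ n ih => rw [Function.iterate_succ_apply', map_mem_boundedOrbitSet_iff, ih]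

theorem eventually_lt_norm_iterate {f : ℂ → ℂ} {R : ℝ} (hR : 0 < R)
    (hf : ∀ z, R < ‖z‖ → 2 * ‖z‖ ≤ ‖f z‖) (N : ℕ) (C : ℝ) :
    ∀ᶠ n in atTop, ∀ z, R < ‖f^[N] z‖ → C < ‖f^[n] z‖ := by
  have h2 : Tendsto (fun n : ℕ => (2 : ℝ) ^ n * R) atTop atTop :=
    (tendsto_pow_atTop_atTop_of_one_lt one_lt_two).atTop_mul_const hR
  obtain ⟨m, hm⟩ := eventually_atTop.1 (h2.eventually_gt_atTop C)
  filter_upwards [eventually_ge_atTop (m + N)] with n hn z hz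
  have hle : m ≤ n - N := by omega
  have h3 := pow_mul_norm_le_norm_iterate hf hz (n - N)
  rw [← Function.iterate_add_apply, Nat.sub_add_cancel (by omega)] at h3
  have h4 : (2 : ℝ) ^ (n - N) * R < 2 ^ (n - N) * ‖f^[N] z‖ := by gcongr
  linarith [hm _ hle]

/-- An orbit that once leaves the disc of radius `R` doubles its modulus forever after. -/
theorem boundedOrbitSet_eq_of_escape {f : ℂ → ℂ} {R : ℝ} (hR : 0 < R)
    (hf : ∀ z, R < ‖z‖ → 2 * ‖z‖ ≤ ‖f z‖) :
    boundedOrbitSet f = {z | ∀ n, ‖f^[n] z‖ ≤ R} := by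
  ext z
  rw [mem_boundedOrbitSet_iff]
  refine ⟨?_, fun h => ⟨R, h⟩⟩
  rintro ⟨C, hC⟩ N
  by_contra! h
  obtain ⟨n, hn⟩ := (eventually_lt_norm_iterate hR hf N C).exists
  exact absurd (hC n) (not_le.2 (hn z h))

theorem continuous_eval_iterate (p : ℂ[X]) (n : ℕ) :
    Continuous (fun z => p.eval z)^[n] :=
  p.continuous.iterate n

theorem exists_bound_filledJulia (p : ℂ[X]) (hp : 2 ≤ p.natDegree) :
    ∃ R : ℝ, 0 < R ∧ ∀ z ∈ filledJulia p, ∀ n : ℕ, ‖(fun z => p.eval z)^[n] z‖ ≤ R := by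
  obtain ⟨R, hR, hf⟩ := exists_escape_radius p hp
  refine ⟨R, hR, fun z hz => ?_⟩
  rwa [filledJulia, boundedOrbitSet_eq_of_escape hR hf] at hz

theorem isClosed_filledJulia (p : ℂ[X]) (hp : 2 ≤ p.natDegree) : IsClosed (filledJulia p) := by
  obtain ⟨R, hR, hf⟩ := exists_escape_radius p hp
  rw [filledJulia, boundedOrbitSet_eq_of_escape hR hf, ofPred_forall]
  exact isClosed_iInter fun n =>
    isClosed_le (continuous_eval_iterate p n).norm continuous_const

/-- Leaving the escape disc at time `N` is an open condition, and growth is uniform from then on;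
compactness makes it uniform on `s`. -/
theorem eventually_lt_norm_iterate_of_isCompact (p : ℂ[X]) (hp : 2 ≤ p.natDegree) {s : Set ℂ}
    (hs : IsCompact s) (hsK : Disjoint s (filledJulia p)) (C : ℝ) :
    ∀ᶠ n in atTop, ∀ z ∈ s, C < ‖(fun z => p.eval z)^[n] z‖ := by
  obtain ⟨R, hR, hf⟩ := exists_escape_radius p hp
  refine hs.induction_on (p := fun t => ∀ᶠ n in atTop, ∀ z ∈ t, C < ‖(fun z => p.eval z)^[n] z‖)
    (by simp) (fun t u htu h => h.mono fun n hn z hz => hn z (htu hz))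
    (fun t u ht hu => ?_) fun z hz => ?_
  · filter_upwards [ht, hu] with n h1 h2 z hz
    exact hz.elim (h1 z) (h2 z)
  · have hzK : z ∉ filledJulia p := disjoint_left.1 hsK hz
    rw [filledJulia, boundedOrbitSet_eq_of_escape hR hf] at hzK
    simp only [mem_ofPred_eq, not_forall, not_le] at hzK
    obtain ⟨N, hN⟩ := hzK
    refine ⟨{w | R < ‖(fun z => p.eval z)^[N] w‖}, mem_nhdsWithin_of_mem_nhds
      ((isOpen_lt continuous_const (continuous_eval_iterate p N).norm).mem_nhds hN), ?_⟩
    exact eventually_lt_norm_iterate hR hf N C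

open Metric in
/-- If `‖f‖` is larger on the boundary circle, relative to `w`, than at the centre, then `f` takes
the value `w` in the disc. -/
theorem exists_mem_ball_eq_of_norm_lt {f : ℂ → ℂ} (hf : Differentiable ℂ f) {a w : ℂ} {r c : ℝ}
    (hr : 0 < r) (hc : 0 < c) (ha : ‖f a - w‖ ≤ c) (h : ∀ z ∈ sphere a r, 2 * c < ‖f z - w‖) :
    ∃ z ∈ ball a r, f z = w := by
  by_contra! hne
  have hne' : ∀ z ∈ closedBall a r, f z - w ≠ 0 := by
    intro z hz h0
    rcases (mem_closedBall.1 hz).lt_or_eq with hlt | heq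
    · exact hne z hlt (sub_eq_zero.1 h0)
    · have := h z heq
      rw [h0, norm_zero] at this
      linarith
  have hd : DiffContOnCl ℂ (fun z => (f z - w)⁻¹) (ball a r) := by
    refine DifferentiableOn.diffContOnCl ?_
    rw [closure_ball a hr.ne']
    exact (hf.sub_const w).differentiableOn.inv hne'
  have hle := Complex.norm_le_of_forall_mem_frontier_norm_le isBounded_ball hd (C := (2 * c)⁻¹)
    (fun z hz => by
      rw [frontier_ball a hr.ne'] at hz
      rw [norm_inv]
      exact inv_anti₀ (by positivity) (h z hz).le) (subset_closure (mem_ball_self hr))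
  rw [norm_inv] at hle
  have hpos : 0 < ‖f a - w‖ := norm_pos_iff.2 (hne' a (mem_closedBall_self hr.le))
  have := (inv_le_inv₀ hpos (by positivity)).1 hle
  linarith

/-- If $K_p=\{a\}$, invariance makes $a$ the only root of $p-a$, so $p(z)=a+c(z-a)^d$ with $d\ge2$.
Then $a$ attracts a whole disc, which lies in $K_p$. -/
theorem filledJulia_ne_singleton (p : ℂ[X]) (hp : 2 ≤ p.natDegree) (a : ℂ) :
    filledJulia p ≠ {a} := by
  intro hK
  have hmem : ∀ z, p.eval z ∈ filledJulia p ↔ z ∈ filledJulia p := fun z =>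
    map_mem_boundedOrbitSet_iff (f := fun z => p.eval z)
  simp only [hK, mem_singleton_iff] at hmem
  set q := p - C a with hq
  have hqdeg : q.natDegree = p.natDegree := natDegree_sub_C
  have hq0 : q ≠ 0 := by
    rintro h
    rw [h, natDegree_zero] at hqdeg
    omega
  have hroots : q.roots = Multiset.replicate p.natDegree a := by
    rw [Multiset.eq_replicate]
    refine ⟨?_, fun z hz => ?_⟩
    · rw [← hqdeg]
      exact (splits_iff_card_roots.1 (IsAlgClosed.splits q))
    · rw [mem_roots hq0, IsRoot, hq, eval_sub, eval_C, sub_eq_zero] at hz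
      exact (hmem z).1 hz
  have heval : ∀ z, p.eval z - a = q.leadingCoeff * (z - a) ^ p.natDegree := by
    intro z
    have h := (IsAlgClosed.splits q).eq_prod_roots
    rw [hroots, Multiset.map_replicate, Multiset.prod_replicate] at h
    have h2 := congrArg (eval z) h
    simpa [hq] using h2
  set c := ‖q.leadingCoeff‖ with hc
  have hc0 : 0 ≤ c := norm_nonneg _
  -- This radius satisfies `ε ≤ 1` and `c * ε ≤ 1`, so the disc is mapped into itself.
  set ε : ℝ := 1 / (c + 1) with hε
  have hε0 : 0 < ε := by positivity
  have hε1 : ε ≤ 1 := by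
    rw [hε, div_le_one (by positivity)]
    linarith
  have hcε : c * ε ≤ 1 := by
    rw [hε, mul_one_div, div_le_one (by positivity)]
    linarith
  have hstep : ∀ z, ‖z - a‖ ≤ ε → ‖p.eval z - a‖ ≤ ε := by
    intro z hz
    rw [heval, norm_mul, norm_pow]
    calc c * ‖z - a‖ ^ p.natDegree ≤ c * ‖z - a‖ ^ 2 := by
          gcongr c * ?_
          exact pow_le_pow_of_le_one (norm_nonneg _) (hz.trans hε1) hp
      _ ≤ c * ε ^ 2 := by gcongr
      _ = (c * ε) * ε := by ring
      _ ≤ 1 * ε := by gcongr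
      _ = ε := one_mul _
  have hiter : ∀ n : ℕ, ‖(fun z => p.eval z)^[n] (a + ε) - a‖ ≤ ε := by
    intro n
    induction n with
    | zero => simp [abs_of_pos hε0]
    | succ n ih =>
      rw [Function.iterate_succ_apply']
      exact hstep _ ih
  have hin : a + (ε : ℂ) ∈ filledJulia p := by
    rw [filledJulia, mem_boundedOrbitSet_iff]
    refine ⟨ε + ‖a‖, fun n => ?_⟩
    have := norm_sub_norm_le ((fun z => p.eval z)^[n] (a + ε)) a
    linarith [hiter n]
  rw [hK, mem_singleton_iff] at hin
  simp [hε0.ne'] at hin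

open Metric in
/-- The filled Julia set has no isolated points. -/
theorem exists_ne_mem_filledJulia (p : ℂ[X]) (hp : 2 ≤ p.natDegree) {a : ℂ}
    (ha : a ∈ filledJulia p) {ε : ℝ} (hε : 0 < ε) :
    ∃ w ∈ filledJulia p, w ≠ a ∧ dist w a < ε := by
  by_contra! hiso
  obtain ⟨R, hR, hbd⟩ := exists_bound_filledJulia p hp
  have hdisj : Disjoint (sphere a (ε / 2)) (filledJulia p) := by
    refine disjoint_left.2 fun z hz hzK => ?_
    rw [mem_sphere] at hz
    have hne : z ≠ a := by
      rintro rfl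
      rw [dist_self] at hz
      linarith
    linarith [hiso z hzK hne]
  -- For $w\in K_p$, `5 * R` gives $|f-w|>4R$ on the circle against at most $2R$ at `a`. So $w$ has
  -- a preimage in the disc, which lies in $K_p$ and must be `a`: $K_p$ would be a single point.
  obtain ⟨n, hn⟩ := (eventually_lt_norm_iterate_of_isCompact p hp (isCompact_sphere a (ε / 2))
    hdisj (5 * R)).exists
  set f := (fun z => p.eval z)^[n] with hf
  have hdiff : Differentiable ℂ f := p.differentiable.iterate n
  have himg : ∀ w ∈ filledJulia p, w = f a := by
    intro w hw
    have hwR : ‖w‖ ≤ R := hbd w hw 0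
    obtain ⟨z, hz, hzw⟩ := exists_mem_ball_eq_of_norm_lt hdiff (a := a) (w := w)
      (r := ε / 2) (c := 2 * R) (by positivity) (by positivity)
      ((norm_sub_le _ _).trans (by linarith [hbd a ha n])) (fun z hz => by
        have h1 := hn z hz
        have h2 := norm_sub_norm_le (f z) w
        linarith)
    have hzK : z ∈ filledJulia p := by
      rw [← hzw] at hw
      exact (iterate_mem_boundedOrbitSet_iff n).1 hw
    by_cases hza : z = a
    · rw [← hzw, hza]
    · rw [mem_ball] at hz
      linarith [hiso z hzK hza]
  refine filledJulia_ne_singleton p hp a (Subset.antisymm (fun w hw => ?_) (by simpa using ha))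
  rw [mem_singleton_iff, himg w hw, ← himg a ha]

/-! ### Eigenvalue pairs, the Newton form and the Jordan normal form -/

/-- The numbers `a` and `b` are the eigenvalues of `M`, counted with multiplicity. -/
def IsEigenvaluePair (M : Matrix (Fin 2) (Fin 2) ℂ) (a b : ℂ) : Prop :=
  M.trace = a + b ∧ M.det = a * b

namespace IsEigenvaluePair

variable {M : Matrix (Fin 2) (Fin 2) ℂ} {a b c d : ℂ}

theorem symm (h : IsEigenvaluePair M a b) : IsEigenvaluePair M b a :=
  ⟨h.1.trans (add_comm _ _), h.2.trans (mul_comm _ _)⟩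

theorem eq_or_eq (h : IsEigenvaluePair M a b) (h' : IsEigenvaluePair M c d) : c = a ∨ c = b := by
  have h0 : (c - a) * (c - b) = 0 := by
    linear_combination (h.2.symm.trans h'.2) - c * (h.1.symm.trans h'.1)
  rcases mul_eq_zero.1 h0 with h1 | h1
  · exact Or.inl (sub_eq_zero.1 h1)
  · exact Or.inr (sub_eq_zero.1 h1)

theorem sub_mul_sub_eq_zero (h : IsEigenvaluePair M a b) : (M - a • 1) * (M - b • 1) = 0 := by
  obtain ⟨h1, h2⟩ := h
  rw [trace_fin_two] at h1
  rw [det_fin_two] at h2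
  ext i j
  fin_cases i <;> fin_cases j <;> simp [mul_apply, Fin.sum_univ_two]
  · linear_combination M 0 0 * h1 - h2
  · linear_combination M 0 1 * h1
  · linear_combination M 1 0 * h1
  · linear_combination M 1 1 * h1 - h2

/-- The characteristic equation gives $|a|^2\le 2\|M\||a|+2\|M\|^2$, which fails for $|a|>3\|M\|$.
-/
theorem norm_le (h : IsEigenvaluePair M a b) : ‖a‖ ≤ 3 * ‖M‖ := by
  have h1 : a * a = M.trace * a - M.det := by linear_combination -a * h.1 + h.2
  have hM : ∀ i j, ‖M i j‖ ≤ ‖M‖ := fun i j => norm_entry_le_entrywise_sup_norm M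
  have ht : ‖M.trace‖ ≤ 2 * ‖M‖ := by
    rw [trace_fin_two]
    exact (norm_add_le _ _).trans (by linarith [hM 0 0, hM 1 1])
  have hd : ‖M.det‖ ≤ 2 * ‖M‖ ^ 2 := by
    rw [det_fin_two]
    have e1 : ‖M 0 0 * M 1 1‖ ≤ ‖M‖ * ‖M‖ := by
      rw [norm_mul]
      exact mul_le_mul (hM _ _) (hM _ _) (norm_nonneg _) (norm_nonneg _)
    have e2 : ‖M 0 1 * M 1 0‖ ≤ ‖M‖ * ‖M‖ := by
      rw [norm_mul]
      exact mul_le_mul (hM _ _) (hM _ _) (norm_nonneg _) (norm_nonneg _)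
    exact (norm_sub_le _ _).trans (by nlinarith)
  have h2 : ‖a‖ * ‖a‖ ≤ 2 * ‖M‖ * ‖a‖ + 2 * ‖M‖ ^ 2 := by
    rw [← norm_mul, h1]
    refine (norm_sub_le _ _).trans ?_
    rw [norm_mul]
    gcongr
  by_contra! hlt
  nlinarith [norm_nonneg M, norm_nonneg a]

theorem smul_one_add_smul (h : IsEigenvaluePair M a b) (s q : ℂ) :
    IsEigenvaluePair (s • 1 + q • (M - a • 1)) s (s + (b - a) * q) := by
  obtain ⟨h1, h2⟩ := h
  rw [trace_fin_two] at h1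
  rw [det_fin_two] at h2
  constructor
  · simp [trace_fin_two]
    linear_combination q * h1
  · simp [det_fin_two]
    linear_combination (s - q * a) * q * h1 + q ^ 2 * h2

/-- The Newton form of `f(M)`: the polynomial `q` is the first divided difference of `f` at `a`. -/
theorem exists_aeval_eq (f : ℂ[X]) (a : ℂ) :
    ∃ q : ℂ[X], (∀ z, f.eval z = f.eval a + (z - a) * q.eval z) ∧
      ∀ {M : Matrix (Fin 2) (Fin 2) ℂ} {b : ℂ}, IsEigenvaluePair M a b →
        aeval M f = f.eval a • 1 + q.eval b • (M - a • 1) := by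
  obtain ⟨q, hq⟩ := X_sub_C_dvd_sub_C_eval (p := f) (a := a)
  have hf : f = C (f.eval a) + (X - C a) * q := by rw [← hq]; ring
  refine ⟨q, fun z => ?_, fun {M b} h => ?_⟩
  · conv_lhs => rw [hf]
    simp
  -- Expanding `q` once more at `b` leaves a remainder divisible by the characteristic polynomial,
  -- which Cayley–Hamilton kills.
  · obtain ⟨s, hs⟩ := X_sub_C_dvd_sub_C_eval (p := q) (a := b)
    have hqs : q = C (q.eval b) + (X - C b) * s := by rw [← hs]; ring
    have hfM : f = C (f.eval a) + (X - C a) * C (q.eval b) + (X - C a) * (X - C b) * s := by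
      conv_lhs => rw [hf, hqs]
      ring
    have h0 := h.sub_mul_sub_eq_zero
    conv_lhs => rw [hfM]
    simp only [map_add, map_mul, map_sub, aeval_X, aeval_C, Algebra.algebraMap_eq_smul_one, h0,
      zero_mul, add_zero, mul_smul_comm, mul_one]

theorem aeval (h : IsEigenvaluePair M a b) (f : ℂ[X]) :
    IsEigenvaluePair (aeval M f) (f.eval a) (f.eval b) := by
  obtain ⟨q, hq, hM⟩ := exists_aeval_eq f a
  rw [hM h, hq b]
  exact h.smul_one_add_smul _ _

theorem conj (Q : GL (Fin 2) ℂ) (a t b : ℂ) :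
    IsEigenvaluePair ((Q : Matrix (Fin 2) (Fin 2) ℂ) * !![a, t; 0, b] *
      ((Q⁻¹ : GL (Fin 2) ℂ) : Matrix (Fin 2) (Fin 2) ℂ)) a b := by
  constructor
  · rw [trace_units_conj]
    simp [trace_fin_two]
  · rw [det_units_conj]
    simp [det_fin_two]

end IsEigenvaluePair

theorem exists_isEigenvaluePair (M : Matrix (Fin 2) (Fin 2) ℂ) :
    ∃ a b, IsEigenvaluePair M a b := by
  obtain ⟨s, hs⟩ := IsAlgClosed.exists_eq_mul_self (M.trace ^ 2 - 4 * M.det)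
  refine ⟨(M.trace + s) / 2, (M.trace - s) / 2, by ring, ?_⟩
  linear_combination -hs / 4

theorem eq_conj_of_mul_eq {M T Q : Matrix (Fin 2) (Fin 2) ℂ} (hQ : Q.det ≠ 0)
    (h : M * Q = Q * T) :
    ∃ Q' : GL (Fin 2) ℂ, M = (Q' : Matrix (Fin 2) (Fin 2) ℂ) * T *
      ((Q'⁻¹ : GL (Fin 2) ℂ) : Matrix (Fin 2) (Fin 2) ℂ) := by
  refine ⟨GeneralLinearGroup.mkOfDetNeZero Q hQ, ?_⟩
  rw [Units.eq_mul_inv_iff_mul_eq]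
  exact h

theorem exists_mulVec_eq_smul {M : Matrix (Fin 2) (Fin 2) ℂ} {a b : ℂ}
    (h : IsEigenvaluePair M a b) : ∃ v : Fin 2 → ℂ, v ≠ 0 ∧ M *ᵥ v = a • v := by
  have hdet : (M - a • 1).det = 0 := by
    obtain ⟨h1, h2⟩ := h
    rw [trace_fin_two] at h1
    rw [det_fin_two] at h2
    simp [det_fin_two]
    linear_combination h2 - a * h1
  obtain ⟨v, hv, hMv⟩ := exists_mulVec_eq_zero_iff.2 hdet
  refine ⟨v, hv, ?_⟩
  rw [sub_mulVec, smul_mulVec, one_mulVec, sub_eq_zero] at hMv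
  exact hMv

/-- The Jordan normal form of a complex `2 × 2` matrix. -/
theorem IsEigenvaluePair.exists_normalForm {M : Matrix (Fin 2) (Fin 2) ℂ} {a b : ℂ}
    (h : IsEigenvaluePair M a b) :
    ∃ (Q : GL (Fin 2) ℂ) (t : ℂ), (t = 0 ∨ t = 1 ∧ a = b) ∧
      M = (Q : Matrix (Fin 2) (Fin 2) ℂ) * !![a, t; 0, b] *
        ((Q⁻¹ : GL (Fin 2) ℂ) : Matrix (Fin 2) (Fin 2) ℂ) := by
  by_cases hab : a = b
  · subst hab
    have h0 := h.sub_mul_sub_eq_zero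
    set N := M - a • 1 with hN
    have hM : M = a • 1 + N := by rw [hN]; abel
    have hsq : ∀ i j, N i 0 * N 0 j + N i 1 * N 1 j = 0 := by
      intro i j
      have := congrFun (congrFun h0 i) j
      simpa [mul_apply, Fin.sum_univ_two] using this
    by_cases h10 : N 1 0 = 0
    · by_cases h01 : N 0 1 = 0
      · have h00 : N 0 0 = 0 := by simpa [h01] using hsq 0 0
        have h11 : N 1 1 = 0 := by simpa [h10] using hsq 1 1
        refine ⟨1, 0, Or.inl rfl, ?_⟩
        rw [hM]
        ext i j
        fin_cases i <;> fin_cases j <;> simp [h00, h01, h10, h11]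
      -- The Jordan basis is `N e, e` with `e` a standard basis vector not killed by `N`; here it is
      -- the second one, below the first.
      · obtain ⟨Q, hQ⟩ := eq_conj_of_mul_eq (M := M) (T := !![a, 1; 0, a])
          (Q := !![N 0 1, 0; N 1 1, 1]) (by simpa [det_fin_two] using h01) (by
            rw [hM]
            ext i j
            fin_cases i <;> fin_cases j <;> simp [mul_apply, Fin.sum_univ_two]
            · linear_combination hsq 0 1
            · linear_combination hsq 1 1
            · ring)
        exact ⟨Q, 1, Or.inr ⟨rfl, rfl⟩, hQ⟩
    · obtain ⟨Q, hQ⟩ := eq_conj_of_mul_eq (M := M) (T := !![a, 1; 0, a])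
        (Q := !![N 0 0, 1; N 1 0, 0]) (by simpa [det_fin_two] using h10) (by
          rw [hM]
          ext i j
          fin_cases i <;> fin_cases j <;> simp [mul_apply, Fin.sum_univ_two]
          · linear_combination hsq 0 0
          · ring
          · linear_combination hsq 1 0)
      exact ⟨Q, 1, Or.inr ⟨rfl, rfl⟩, hQ⟩
  · obtain ⟨v, hv, hMv⟩ := exists_mulVec_eq_smul h
    obtain ⟨w, hw, hMw⟩ := exists_mulVec_eq_smul h.symm
    have hv0 := congrFun hMv 0
    have hv1 := congrFun hMv 1
    have hw0 := congrFun hMw 0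
    have hw1 := congrFun hMw 1
    simp [mulVec, dotProduct, Fin.sum_univ_two] at hv0 hv1 hw0 hw1
    obtain ⟨Q, hQ⟩ := eq_conj_of_mul_eq (M := M) (T := !![a, 0; 0, b])
      (Q := !![v 0, w 0; v 1, w 1]) (by
        intro hdet
        rw [det_fin_two] at hdet
        simp at hdet
        have hba : b - a ≠ 0 := sub_ne_zero.2 (Ne.symm hab)
        -- If the eigenvectors were dependent, comparing the two eigenvalue equations would kill
        -- every product of their coordinates.
        have e : ∀ i j, v i * w j = 0 := by
          have e00 : (b - a) * (v 0 * w 0) = 0 := by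
            linear_combination w 0 * hv0 - v 0 * hw0 + M 0 1 * hdet
          have e01 : (b - a) * (v 0 * w 1) = 0 := by
            linear_combination w 1 * hv0 - v 1 * hw0 - M 0 0 * hdet + b * hdet
          have e11 : (b - a) * (v 1 * w 1) = 0 := by
            linear_combination w 1 * hv1 - v 1 * hw1 - M 1 0 * hdet
          have z01 := (mul_eq_zero.1 e01).resolve_left hba
          intro i j
          fin_cases i <;> fin_cases j
          · exact (mul_eq_zero.1 e00).resolve_left hba
          · exact z01
          · change v 1 * w 0 = 0
            linear_combination z01 - hdet
          · exact (mul_eq_zero.1 e11).resolve_left hba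
        have hv' : ∃ i, v i ≠ 0 := Function.ne_iff.1 hv
        have hw' : ∃ i, w i ≠ 0 := Function.ne_iff.1 hw
        obtain ⟨i, hi⟩ := hv'
        obtain ⟨j, hj⟩ := hw'
        exact mul_ne_zero hi hj (e i j)) (by
        ext i j
        fin_cases i <;> fin_cases j <;> simp [mul_apply, Fin.sum_univ_two]
        · linear_combination hv0
        · linear_combination hw0
        · linear_combination hv1
        · linear_combination hw1)
    exact ⟨Q, 0, Or.inl rfl, hQ⟩

/-! ### Continuity of eigenvalues -/

-- The characteristic polynomial of `N` at `a` is $(c-a)(d-a)$ and tends to $0$ as `N` tends to `M`,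
-- so one factor is small.
open Topology Metric in
theorem isOpen_exists_isEigenvaluePair {V : Set ℂ} (hV : IsOpen V) :
    IsOpen {M | ∃ a b, IsEigenvaluePair M a b ∧ a ∈ V} := by
  rw [isOpen_iff_mem_nhds]
  rintro M ⟨a, b, h, ha⟩
  obtain ⟨ε, hε, hεV⟩ := Metric.isOpen_iff.1 hV a ha
  have hcont : Continuous fun N : Matrix (Fin 2) (Fin 2) ℂ => ‖a * a - N.trace * a + N.det‖ :=
    ((continuous_const.sub (continuous_id.matrix_trace.mul continuous_const)).add
      continuous_id.matrix_det).norm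
  have hM : ‖a * a - M.trace * a + M.det‖ < ε * ε := by
    have : a * a - M.trace * a + M.det = 0 := by linear_combination -a * h.1 + h.2
    rw [this, norm_zero]
    positivity
  filter_upwards [hcont.continuousAt.eventually_lt_const hM] with N hN
  obtain ⟨c, d, hcd⟩ := exists_isEigenvaluePair N
  have heq : a * a - N.trace * a + N.det = (c - a) * (d - a) := by
    linear_combination -a * hcd.1 + hcd.2
  rw [heq, norm_mul] at hN
  rcases lt_or_ge ‖c - a‖ ε with hc | hc
  · exact ⟨c, d, hcd, hεV (by rwa [mem_ball, dist_eq_norm])⟩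
  · refine ⟨d, c, hcd.symm, hεV ?_⟩
    rw [mem_ball, dist_eq_norm]
    by_contra! hd
    exact absurd hN (not_lt.2 (mul_le_mul hc hd hε.le (norm_nonneg _)))

-- Eigenvalues outside `V` along a convergent sequence are bounded, and a subsequential limit is an
-- eigenvalue of the limit, still outside `V`.
open Topology in
theorem isOpen_forall_isEigenvaluePair {V : Set ℂ} (hV : IsOpen V) :
    IsOpen {M | ∀ a b, IsEigenvaluePair M a b → a ∈ V} := by
  have : SequentialSpace (Matrix (Fin 2) (Fin 2) ℂ) :=
    inferInstanceAs (SequentialSpace (Fin 2 → Fin 2 → ℂ))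
  rw [← isClosed_compl_iff, ← isSeqClosed_iff_isClosed]
  intro u M hu hM
  have hex : ∀ n, ∃ a b, IsEigenvaluePair (u n) a b ∧ a ∈ Vᶜ := by
    intro n
    have := hu n
    simp only [mem_compl_iff, mem_ofPred_eq, not_forall, exists_prop] at this
    exact this
  choose a b hab ha using hex
  obtain ⟨C, hC⟩ := (Metric.isBounded_range_of_tendsto u hM).exists_norm_le
  obtain ⟨z, -, φ, hφ, hz⟩ := tendsto_subseq_of_bounded
    (Metric.isBounded_closedBall (x := (0 : ℂ)) (r := 3 * C)) (x := a) (fun n => by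
      rw [mem_closedBall_zero_iff]
      linarith [(hab n).norm_le, hC _ (mem_range_self n)])
  have hMφ := hM.comp hφ.tendsto_atTop
  have htr : Tendsto (fun n => (u (φ n)).trace) atTop (𝓝 M.trace) :=
    (continuous_id.matrix_trace.tendsto M).comp hMφ
  have hdet : Tendsto (fun n => (u (φ n)).det) atTop (𝓝 M.det) :=
    (continuous_id.matrix_det.tendsto M).comp hMφ
  have heq : ∀ n, (u (φ n)).det = a (φ n) * ((u (φ n)).trace - a (φ n)) := by
    intro n
    rw [(hab (φ n)).1, (hab (φ n)).2]
    ring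
  have hlim : M.det = z * (M.trace - z) := by
    refine tendsto_nhds_unique hdet ?_
    simp only [heq]
    exact hz.mul (htr.sub hz)
  have hzV : z ∈ Vᶜ := hV.isClosed_compl.mem_of_tendsto hz (Eventually.of_forall fun n => ha _)
  intro hall
  exact hzV (hall z (M.trace - z) ⟨by ring, hlim⟩)

open Topology in
/-- The eigenvalues of a matrix can be prescribed arbitrarily close to the given ones by a small
perturbation of the matrix. -/
theorem IsEigenvaluePair.eventually_exists_mem {M : Matrix (Fin 2) (Fin 2) ℂ} {a b : ℂ}
    (h : IsEigenvaluePair M a b) {W : Set (Matrix (Fin 2) (Fin 2) ℂ)} (hW : W ∈ 𝓝 M) :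
    ∀ᶠ x : ℂ × ℂ in 𝓝 (a, b), ∃ N ∈ W, IsEigenvaluePair N x.1 x.2 := by
  -- Keep `Q` and `t` fixed and vary only the diagonal of the triangular form.
  obtain ⟨Q, t, -, hM⟩ := h.exists_normalForm
  have hcont : Continuous fun x : ℂ × ℂ => (Q : Matrix (Fin 2) (Fin 2) ℂ) * !![x.1, t; 0, x.2] *
      ((Q⁻¹ : GL (Fin 2) ℂ) : Matrix (Fin 2) (Fin 2) ℂ) := by
    refine Continuous.matrix_mul (Continuous.matrix_mul continuous_const ?_) continuous_const
    refine continuous_matrix fun i j => ?_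
    fin_cases i <;> fin_cases j <;> simp <;> fun_prop
  rw [hM] at hW
  filter_upwards [hcont.continuousAt (x := (a, b)) hW] with x hx
  exact ⟨_, hx, IsEigenvaluePair.conj Q _ _ _⟩

/-! ### Norm bounds for the iterates -/

theorem matrixPoly_iterate (p : ℂ[X]) (n : ℕ) (M : Matrix (Fin 2) (Fin 2) ℂ) :
    (matrixPoly p)^[n] M = aeval M (p.comp^[n] X) := by
  induction n with
  | zero => simp
  | succ n ih =>
    rw [Function.iterate_succ_apply', Function.iterate_succ_apply', ih, aeval_comp]
    rfl

theorem IsEigenvaluePair.matrixPoly_iterate {M : Matrix (Fin 2) (Fin 2) ℂ} {a b : ℂ}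
    (h : IsEigenvaluePair M a b) (p : ℂ[X]) (n : ℕ) :
    IsEigenvaluePair ((matrixPoly p)^[n] M) ((fun z => p.eval z)^[n] a)
      ((fun z => p.eval z)^[n] b) := by
  have := h.aeval (p.comp^[n] X)
  rwa [iterate_comp_eval, iterate_comp_eval, eval_X, eval_X, ← _root_.matrixPoly_iterate] at this

theorem norm_one_le_one : ‖(1 : Matrix (Fin 2) (Fin 2) ℂ)‖ ≤ 1 := by
  rw [Matrix.norm_le_iff zero_le_one]
  intro i j
  fin_cases i <;> fin_cases j <;> simp

open Metric in
/-- A bound on `f(M)` in terms of bounds on `f`, for eigenvalues that are either `δ`-separated or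
such that `f` is bounded on a disc of radius `δ`. -/
theorem IsEigenvaluePair.norm_aeval_le {M : Matrix (Fin 2) (Fin 2) ℂ} {a b : ℂ}
    (h : IsEigenvaluePair M a b) {f : ℂ[X]} {R δ : ℝ} (hδ : 0 < δ) (ha : ‖f.eval a‖ ≤ R)
    (hb : ‖f.eval b‖ ≤ R) (hab : δ ≤ ‖b - a‖ ∨ ∀ z ∈ sphere a δ, ‖f.eval z‖ ≤ R) :
    ‖Polynomial.aeval M f‖ ≤ R + 2 * R / δ * (4 * ‖M‖) := by
  obtain ⟨q, hq, hM⟩ := exists_aeval_eq f a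
  have hR : 0 ≤ R := (norm_nonneg _).trans ha
  have key : ∀ z, ‖f.eval z‖ ≤ R → δ ≤ ‖z - a‖ → ‖q.eval z‖ ≤ 2 * R / δ := by
    intro z hz hza
    rw [le_div_iff₀ hδ]
    have h1 : (z - a) * q.eval z = f.eval z - f.eval a := by rw [hq z]; ring
    calc ‖q.eval z‖ * δ ≤ ‖q.eval z‖ * ‖z - a‖ := by gcongr
      _ = ‖f.eval z - f.eval a‖ := by rw [← h1, norm_mul, mul_comm]
      _ ≤ 2 * R := (norm_sub_le _ _).trans (by linarith)
  have hqb : ‖q.eval b‖ ≤ 2 * R / δ := by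
    by_cases hd : δ ≤ ‖b - a‖
    · exact key b hb hd
    -- For close eigenvalues the quotient bound is applied on the circle and carried inside by the
    -- maximum principle.
    · have hsph := hab.resolve_left hd
      refine Complex.norm_le_of_forall_mem_frontier_norm_le (U := ball a δ) isBounded_ball
        (q.differentiable.diffContOnCl) (fun z hz => ?_)
        (subset_closure (by rw [mem_ball, dist_eq_norm]; exact not_le.1 hd))
      rw [frontier_ball a hδ.ne'] at hz
      refine key z (hsph z hz) ?_
      rw [mem_sphere, dist_eq_norm] at hz
      exact hz.ge
  rw [hM h]
  have h1 := norm_one_le_one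
  have hMa : ‖M - a • (1 : Matrix (Fin 2) (Fin 2) ℂ)‖ ≤ 4 * ‖M‖ := by
    refine (norm_sub_le _ _).trans ?_
    rw [norm_smul]
    have := mul_le_of_le_one_right (norm_nonneg a) h1
    linarith [h.norm_le]
  refine (norm_add_le _ _).trans ?_
  rw [norm_smul, norm_smul]
  exact add_le_add ((mul_le_of_le_one_right (norm_nonneg _) h1).trans ha)
    (mul_le_mul hqb hMa (norm_nonneg _) (by positivity))

open Metric in
theorem IsEigenvaluePair.norm_matrixPoly_iterate_le {p : ℂ[X]}
    {M : Matrix (Fin 2) (Fin 2) ℂ} {a b : ℂ} (h : IsEigenvaluePair M a b) {R δ : ℝ} (hδ : 0 < δ)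
    (hR : ∀ z ∈ filledJulia p, ∀ n : ℕ, ‖(fun z => p.eval z)^[n] z‖ ≤ R)
    (ha : a ∈ filledJulia p) (hb : b ∈ filledJulia p)
    (hab : δ ≤ ‖b - a‖ ∨ sphere a δ ⊆ filledJulia p) (n : ℕ) :
    ‖(matrixPoly p)^[n] M‖ ≤ R + 2 * R / δ * (4 * ‖M‖) := by
  have he : ∀ z ∈ filledJulia p, ‖(p.comp^[n] X).eval z‖ ≤ R := by
    intro z hz
    rw [iterate_comp_eval, eval_X]
    exact hR z hz n
  rw [_root_.matrixPoly_iterate]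
  exact h.norm_aeval_le hδ (he a ha) (he b hb) (hab.imp_right fun hs z hz => he z (hs hz))

/-! ### The set of matrices with spectrum in the filled Julia set -/

/-- The matrices all of whose eigenvalues lie in the filled Julia set. -/
def spectralFilledJulia (p : ℂ[X]) : Set (Matrix (Fin 2) (Fin 2) ℂ) :=
  {M | ∀ a b, IsEigenvaluePair M a b → a ∈ filledJulia p}

theorem IsEigenvaluePair.mem_spectralFilledJulia_iff {p : ℂ[X]}
    {M : Matrix (Fin 2) (Fin 2) ℂ} {a b : ℂ} (h : IsEigenvaluePair M a b) :
    M ∈ spectralFilledJulia p ↔ a ∈ filledJulia p ∧ b ∈ filledJulia p := by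
  refine ⟨fun hM => ⟨hM a b h, hM b a h.symm⟩, ?_⟩
  rintro ⟨ha, hb⟩ c d hcd
  rcases h.eq_or_eq hcd with rfl | rfl
  · exact ha
  · exact hb

theorem isClosed_spectralFilledJulia (p : ℂ[X]) (hp : 2 ≤ p.natDegree) :
    IsClosed (spectralFilledJulia p) := by
  have h := isOpen_exists_isEigenvaluePair (isClosed_filledJulia p hp).isOpen_compl
  rw [← isOpen_compl_iff]
  convert h using 1
  ext M
  simp [spectralFilledJulia]

theorem boundedOrbitSet_subset_spectralFilledJulia (p : ℂ[X]) :
    boundedOrbitSet (matrixPoly p) ⊆ spectralFilledJulia p := by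
  intro M hM a b hab
  obtain ⟨C, hC⟩ := mem_boundedOrbitSet_iff.1 hM
  rw [filledJulia, mem_boundedOrbitSet_iff]
  exact ⟨3 * C, fun n => by linarith [(hab.matrixPoly_iterate p n).norm_le, hC n]⟩

theorem IsEigenvaluePair.mem_boundedOrbitSet {p : ℂ[X]} (hp : 2 ≤ p.natDegree)
    {M : Matrix (Fin 2) (Fin 2) ℂ} {a b : ℂ} (h : IsEigenvaluePair M a b) (hne : b ≠ a)
    (ha : a ∈ filledJulia p) (hb : b ∈ filledJulia p) : M ∈ boundedOrbitSet (matrixPoly p) := by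
  obtain ⟨R, -, hR⟩ := exists_bound_filledJulia p hp
  exact mem_boundedOrbitSet_iff.2 ⟨_, fun n => h.norm_matrixPoly_iterate_le
    (norm_pos_iff.2 (sub_ne_zero.2 hne)) hR ha hb (Or.inl le_rfl) n⟩

/-- Only a double eigenvalue is an obstacle; one copy is moved to a nearby point of $K_p$. -/
theorem closure_boundedOrbitSet_matrixPoly (p : ℂ[X]) (hp : 2 ≤ p.natDegree) :
    closure (boundedOrbitSet (matrixPoly p)) = spectralFilledJulia p := by
  refine Subset.antisymm (closure_minimal (boundedOrbitSet_subset_spectralFilledJulia p)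
    (isClosed_spectralFilledJulia p hp)) fun M hM => ?_
  obtain ⟨a, b, hab⟩ := exists_isEigenvaluePair M
  obtain ⟨ha, hb⟩ := hab.mem_spectralFilledJulia_iff.1 hM
  by_cases hne : b = a
  · subst hne
    rw [mem_closure_iff_nhds]
    intro W hW
    have hev := hab.eventually_exists_mem hW
    obtain ⟨ε, hε, hball⟩ := Metric.eventually_nhds_iff.1 hev
    obtain ⟨w, hw, hwne, hwd⟩ := exists_ne_mem_filledJulia p hp hb hε
    obtain ⟨N, hNW, hN⟩ := hball (y := (b, w)) (by simpa [Prod.dist_eq, hε] using hwd)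
    exact ⟨N, hNW, hN.mem_boundedOrbitSet hp hwne hb hw⟩
  · exact subset_closure (hab.mem_boundedOrbitSet hp hne ha hb)

theorem mem_interior_spectralFilledJulia {p : ℂ[X]} {M : Matrix (Fin 2) (Fin 2) ℂ} {a b : ℂ}
    (h : IsEigenvaluePair M a b) (ha : a ∈ interior (filledJulia p))
    (hb : b ∈ interior (filledJulia p)) : M ∈ interior (spectralFilledJulia p) := by
  refine mem_interior.2 ⟨{N | ∀ c d, IsEigenvaluePair N c d → c ∈ interior (filledJulia p)},
    fun N hN c d hcd => interior_subset (hN c d hcd),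
    isOpen_forall_isEigenvaluePair isOpen_interior, fun c d hcd => ?_⟩
  rcases h.eq_or_eq hcd with rfl | rfl
  · exact ha
  · exact hb

-- The eigenvalue `a` can be moved freely near its place while `b` stays fixed.
open Topology in
theorem mem_interior_filledJulia_of_mem_interior {p : ℂ[X]} {M : Matrix (Fin 2) (Fin 2) ℂ}
    {a b : ℂ} (h : IsEigenvaluePair M a b) (hM : M ∈ interior (spectralFilledJulia p)) :
    a ∈ interior (filledJulia p) := by
  have hev := h.eventually_exists_mem (mem_interior_iff_mem_nhds.1 hM)
  have hmap : Tendsto (fun z : ℂ => (z, b)) (𝓝 a) (𝓝 (a, b)) :=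
    (Continuous.prodMk_left b).tendsto a
  rw [mem_interior_iff_mem_nhds]
  filter_upwards [hmap.eventually hev] with z hz
  obtain ⟨N, hN, hzb⟩ := hz
  exact hN z b hzb

theorem mem_frontier_spectralFilledJulia_iff {p : ℂ[X]} (hp : 2 ≤ p.natDegree)
    {M : Matrix (Fin 2) (Fin 2) ℂ} {a b : ℂ} (h : IsEigenvaluePair M a b) :
    M ∈ frontier (spectralFilledJulia p) ↔
      (a, b) ∈ (filledJulia p ×ˢ polyJulia p) ∪ (polyJulia p ×ˢ filledJulia p) := by
  have hint : M ∈ interior (spectralFilledJulia p) ↔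
      a ∈ interior (filledJulia p) ∧ b ∈ interior (filledJulia p) :=
    ⟨fun hM => ⟨mem_interior_filledJulia_of_mem_interior h hM,
      mem_interior_filledJulia_of_mem_interior h.symm hM⟩,
      fun hM => mem_interior_spectralFilledJulia h hM.1 hM.2⟩
  rw [polyJulia, (isClosed_filledJulia p hp).frontier_eq,
    (isClosed_spectralFilledJulia p hp).frontier_eq, Set.mem_sdiff, hint,
    h.mem_spectralFilledJulia_iff]
  simp only [mem_union, mem_prod, Set.mem_sdiff]
  tauto

theorem frontier_spectralFilledJulia (p : ℂ[X]) (hp : 2 ≤ p.natDegree) :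
    frontier (spectralFilledJulia p) =
      {M | ∃ (Q : GL (Fin 2) ℂ) (a b : ℂ),
          (a, b) ∈ (filledJulia p ×ˢ polyJulia p) ∪ (polyJulia p ×ˢ filledJulia p) ∧
          M = (Q : Matrix (Fin 2) (Fin 2) ℂ) * !![a, 0; 0, b] *
            ((Q⁻¹ : GL (Fin 2) ℂ) : Matrix (Fin 2) (Fin 2) ℂ)} ∪
      {M | ∃ (Q : GL (Fin 2) ℂ) (a : ℂ), a ∈ polyJulia p ∧
          M = (Q : Matrix (Fin 2) (Fin 2) ℂ) * !![a, 1; 0, a] *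
            ((Q⁻¹ : GL (Fin 2) ℂ) : Matrix (Fin 2) (Fin 2) ℂ)} := by
  have hJK : polyJulia p ⊆ filledJulia p := (isClosed_filledJulia p hp).frontier_subset
  ext M
  constructor
  · intro hM
    obtain ⟨a, b, hab⟩ := exists_isEigenvaluePair M
    have hmem := (mem_frontier_spectralFilledJulia_iff hp hab).1 hM
    obtain ⟨Q, t, ht, hQ⟩ := hab.exists_normalForm
    rcases ht with rfl | ⟨rfl, rfl⟩
    · exact Or.inl ⟨Q, a, b, hmem, hQ⟩
    · exact Or.inr ⟨Q, a, hmem.elim And.right And.left, hQ⟩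
  · rintro (⟨Q, a, b, hmem, rfl⟩ | ⟨Q, a, ha, rfl⟩)
    · exact (mem_frontier_spectralFilledJulia_iff hp (IsEigenvaluePair.conj Q a 0 b)).2 hmem
    · exact (mem_frontier_spectralFilledJulia_iff hp (IsEigenvaluePair.conj Q a 1 a)).2
        (Or.inl ⟨hJK ha, ha⟩)

/-! ### Normality and the Julia set -/

/-- Normality concerns arbitrary sequences of iterates, whose exponents may repeat. -/
theorem exists_subseq_const_or_tendsto_atTop (k : ℕ → ℕ) :
    ∃ φ : ℕ → ℕ, StrictMono φ ∧ ((∃ c, ∀ n, k (φ n) = c) ∨ Tendsto (k ∘ φ) atTop atTop) := by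
  by_cases h : ∀ c, ∀ᶠ n in atTop, k n ≠ c
  · refine ⟨id, strictMono_id, Or.inr (tendsto_atTop.2 fun B => ?_)⟩
    have h1 : ∀ᶠ n in atTop, ∀ c ∈ Finset.range B, k n ≠ c :=
      (Finset.eventually_all _).2 fun c _ => h c
    filter_upwards [h1] with n hn
    by_contra! hlt
    exact hn (k n) (Finset.mem_range.2 hlt) rfl
  · push Not at h
    obtain ⟨c, hc⟩ := h
    obtain ⟨φ, hφ, hφc⟩ := extraction_of_frequently_atTop hc
    exact ⟨φ, hφ, Or.inl ⟨c, hφc⟩⟩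

theorem differentiable_matrix_mul {E : Type*} [NormedAddCommGroup E] [NormedSpace ℂ E]
    {f g : E → Matrix (Fin 2) (Fin 2) ℂ} (hf : Differentiable ℂ f) (hg : Differentiable ℂ g) :
    Differentiable ℂ fun x => f x * g x := by
  have hfe : ∀ i j, Differentiable ℂ fun x => f x i j := fun i j =>
    differentiable_pi.1 (differentiable_pi.1 hf i) j
  have hge : ∀ i j, Differentiable ℂ fun x => g x i j := fun i j =>
    differentiable_pi.1 (differentiable_pi.1 hg i) j
  refine differentiable_pi.2 fun i => differentiable_pi.2 fun j => ?_
  simp only [mul_apply, Fin.sum_univ_two]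
  exact ((hfe i 0).mul (hge 0 j)).add ((hfe i 1).mul (hge 1 j))

theorem differentiable_matrixPoly (p : ℂ[X]) : Differentiable ℂ (matrixPoly p) := by
  have hpow : ∀ n : ℕ, Differentiable ℂ fun M : Matrix (Fin 2) (Fin 2) ℂ => M ^ n := by
    intro n
    induction n with
    | zero => simp only [pow_zero]; exact differentiable_const _
    | succ n ih => simp only [pow_succ]; exact differentiable_matrix_mul ih differentiable_id
  have heq : matrixPoly p = fun M => ∑ i ∈ Finset.range (p.natDegree + 1), p.coeff i • M ^ i :=
    funext fun M => aeval_eq_sum_range M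
  rw [heq]
  exact Differentiable.fun_sum fun i _ => (hpow i).fun_const_smul _

-- Nearby matrices keep an eigenvalue in a disc off $K_p$; it escapes uniformly and bounds the norm
-- from below.
open Metric in
theorem compl_spectralFilledJulia_subset_fatouSet (p : ℂ[X]) (hp : 2 ≤ p.natDegree) :
    (spectralFilledJulia p)ᶜ ⊆ fatouSet (matrixPoly p) := by
  intro M hM
  simp only [spectralFilledJulia, mem_compl_iff, mem_ofPred_eq, not_forall, exists_prop] at hM
  obtain ⟨a, b, hab, ha⟩ := hM
  obtain ⟨r, hr, hrK⟩ := nhds_basis_closedBall.mem_iff.1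
    ((isClosed_filledJulia p hp).isOpen_compl.mem_nhds ha)
  have hesc := eventually_lt_norm_iterate_of_isCompact p hp (isCompact_closedBall a r)
    (disjoint_left.2 hrK)
  refine ⟨_, isOpen_exists_isEigenvaluePair (isOpen_ball (x := a) (ε := r)),
    ⟨a, b, hab, mem_ball_self hr⟩, fun u hu => ?_⟩
  choose k _ hk using hu
  obtain ⟨φ, hφ, ⟨c, hc⟩ | hlim⟩ := exists_subseq_const_or_tendsto_atTop k
  · refine ⟨φ, hφ, Or.inl ⟨(matrixPoly p)^[c],
      ((differentiable_matrixPoly p).iterate c).differentiableOn, ?_⟩⟩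
    have hconst : (fun n => u (φ n)) = fun _ => (matrixPoly p)^[c] :=
      funext fun n => by rw [hk, hc]
    rw [hconst]
    exact fun v hv x _ => ⟨univ, univ_mem, by simp [refl_mem_uniformity hv]⟩
  · refine ⟨φ, hφ, Or.inr fun s hs _ C => ?_⟩
    filter_upwards [hlim.eventually (hesc (3 * C))] with n hn N hN
    obtain ⟨c, d, hcd, hc⟩ := hs hN
    have h1 := hn c (ball_subset_closedBall hc)
    have h2 := (hcd.matrixPoly_iterate p (k (φ n))).norm_le
    rw [hk]
    simp only [Function.comp_apply] at h1
    linarith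

open Metric Topology in
/-- The iterates of `P` are bounded near a matrix whose eigenvalues are interior points of the
filled Julia set. -/
theorem eventually_norm_matrixPoly_iterate_le {p : ℂ[X]} (hp : 2 ≤ p.natDegree)
    {M : Matrix (Fin 2) (Fin 2) ℂ} (hM : M ∈ interior (spectralFilledJulia p)) :
    ∃ C : ℝ, ∀ᶠ N in 𝓝 M, ∀ n : ℕ, ‖(matrixPoly p)^[n] N‖ ≤ C := by
  obtain ⟨R, hR0, hR⟩ := exists_bound_filledJulia p hp
  obtain ⟨a, b, hab⟩ := exists_isEigenvaluePair M
  have ha := mem_interior_filledJulia_of_mem_interior hab hM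
  have hb := mem_interior_filledJulia_of_mem_interior hab.symm hM
  -- Half of `δ` absorbs the motion of the eigenvalues; the other half is the radius of a disc in
  -- $K_p$ about each.
  obtain ⟨δ, hδ, hδK⟩ := ((Set.toFinite {a, b}).isCompact.exists_cthickening_subset_open
    isOpen_interior (insert_subset ha (singleton_subset_iff.2 hb)))
  have hsub : ∀ c ∈ ({a, b} : Set ℂ), closedBall c δ ⊆ filledJulia p := fun c hc =>
    ((closedBall_subset_cthickening hc δ).trans hδK).trans interior_subset
  have hV : IsOpen (ball a (δ / 2) ∪ ball b (δ / 2)) := isOpen_ball.union isOpen_ball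
  have hW : {N | ∀ c d, IsEigenvaluePair N c d → c ∈ ball a (δ / 2) ∪ ball b (δ / 2)} ∈ 𝓝 M := by
    refine (isOpen_forall_isEigenvaluePair hV).mem_nhds fun c d hcd => ?_
    rcases hab.eq_or_eq hcd with rfl | rfl
    · exact Or.inl (mem_ball_self (by positivity))
    · exact Or.inr (mem_ball_self (by positivity))
  have hball : ∀ c ∈ ball a (δ / 2) ∪ ball b (δ / 2), closedBall c (δ / 2) ⊆ filledJulia p := by
    rintro c (hc | hc)
    · refine (closedBall_subset_closedBall' ?_).trans (hsub a (by simp))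
      linarith [mem_ball.1 hc]
    · refine (closedBall_subset_closedBall' ?_).trans (hsub b (by simp))
      linarith [mem_ball.1 hc]
  have hnorm : ∀ᶠ N in 𝓝 M, ‖N‖ < ‖M‖ + 1 :=
    continuous_norm.continuousAt.eventually_lt_const (lt_add_one _)
  refine ⟨R + 2 * R / (δ / 2) * (4 * (‖M‖ + 1)), ?_⟩
  filter_upwards [hW, hnorm] with N hN hNn n
  obtain ⟨c, d, hcd⟩ := exists_isEigenvaluePair N
  have hc := hball c (hN c d hcd)
  have hd := hball d (hN d c hcd.symm)
  refine (hcd.norm_matrixPoly_iterate_le (half_pos hδ) hR (hc (mem_closedBall_self (by positivity)))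
    (hd (mem_closedBall_self (by positivity))) (Or.inr (sphere_subset_closedBall.trans hc)) n).trans ?_
  gcongr

open Metric in
theorem interior_spectralFilledJulia_subset_fatouSet (p : ℂ[X]) (hp : 2 ≤ p.natDegree) :
    interior (spectralFilledJulia p) ⊆ fatouSet (matrixPoly p) := by
  intro M hM
  obtain ⟨C, hC⟩ := eventually_norm_matrixPoly_iterate_le hp hM
  obtain ⟨ρ, hρ, hρC⟩ := Metric.eventually_nhds_iff_ball.1 hC
  obtain ⟨r, rfl⟩ : ∃ r, ρ = 3 * r := ⟨ρ / 3, by ring⟩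
  have hr : 0 < r := by linarith
  refine ⟨ball M r, isOpen_ball, mem_ball_self hr, fun u hu => ?_⟩
  choose k _ hk using hu
  have : ProperSpace (Matrix (Fin 2) (Fin 2) ℂ) := FiniteDimensional.proper ℂ _
  obtain ⟨φ, hφ, g, hg, hlim⟩ := exists_subseq_tendstoUniformlyOn_of_bounded (u := u) (x := M)
    (C := C) hr (fun n => by
      rw [hk]
      exact ((differentiable_matrixPoly p).iterate _).differentiableOn)
    (fun n N hN => by
      rw [hk]
      exact hρC N hN _)
  exact ⟨φ, hφ, Or.inl ⟨g, hg, hlim.tendstoLocallyUniformlyOn⟩⟩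

/-- Every neighbourhood contains `A` with bounded orbit, excluding divergence, and `B` with an
escaping eigenvalue, excluding convergence. -/
theorem disjoint_fatouSet_frontier_spectralFilledJulia (p : ℂ[X]) (hp : 2 ≤ p.natDegree) :
    Disjoint (fatouSet (matrixPoly p)) (frontier (spectralFilledJulia p)) := by
  refine disjoint_left.2 fun M ⟨U, hU, hMU, hnorm⟩ hM => ?_
  have hcl : M ∈ closure (boundedOrbitSet (matrixPoly p)) := by
    rw [closure_boundedOrbitSet_matrixPoly p hp]
    exact (isClosed_spectralFilledJulia p hp).frontier_subset hM
  rw [frontier_eq_closure_inter_closure] at hM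
  obtain ⟨A, hAU, hA⟩ := mem_closure_iff.1 hcl U hU hMU
  obtain ⟨B, hBU, hB⟩ := mem_closure_iff.1 hM.2 U hU hMU
  obtain ⟨φ, hφ, ⟨g, -, hg⟩ | hdiv⟩ := hnorm (fun n => (matrixPoly p)^[n + 1])
    (fun n => ⟨n + 1, by omega, rfl⟩)
  · simp only [spectralFilledJulia, mem_compl_iff, mem_ofPred_eq, not_forall, exists_prop] at hB
    obtain ⟨a, b, hab, ha⟩ := hB
    obtain ⟨C, hC⟩ := (Metric.isBounded_range_of_tendsto _ (hg.tendsto_at hBU)).exists_norm_le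
    have hesc := eventually_lt_norm_iterate_of_isCompact p hp (isCompact_singleton (x := a))
      (disjoint_singleton_left.2 ha) (3 * C)
    have hφ' : Tendsto (fun n => φ n + 1) atTop atTop :=
      tendsto_atTop_mono (fun n => Nat.le_succ _) hφ.tendsto_atTop
    obtain ⟨n, hn⟩ := (hφ'.eventually hesc).exists
    have h1 := hn a rfl
    have h2 := (hab.matrixPoly_iterate p (φ n + 1)).norm_le
    have h3 := hC _ (mem_range_self n)
    linarith
  · obtain ⟨C, hC⟩ := mem_boundedOrbitSet_iff.1 hA
    obtain ⟨n, hn⟩ := (hdiv {A} (singleton_subset_iff.2 hAU) isCompact_singleton C).exists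
    exact absurd (hC (φ n + 1)) (not_le.2 (hn A rfl))

theorem juliaSet_matrixPoly (p : ℂ[X]) (hp : 2 ≤ p.natDegree) :
    juliaSet (matrixPoly p) = frontier (spectralFilledJulia p) := by
  refine Subset.antisymm (fun M hM => ?_)
    (disjoint_left.1 (disjoint_fatouSet_frontier_spectralFilledJulia p hp).symm)
  rw [(isClosed_spectralFilledJulia p hp).frontier_eq]
  refine ⟨?_, fun h => hM (interior_spectralFilledJulia_subset_fatouSet p hp h)⟩
  by_contra h
  exact hM (compl_spectralFilledJulia_subset_fatouSet p hp h)

theorem theorem1p1 (p : ℂ[X]) (hp : 2 ≤ p.natDegree) :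
    juliaSet (matrixPoly p) = frontier (closure (boundedOrbitSet (matrixPoly p))) ∧
    juliaSet (matrixPoly p) =
      {M | ∃ (Q : GL (Fin 2) ℂ) (a b : ℂ),
          (a, b) ∈ (filledJulia p ×ˢ polyJulia p) ∪ (polyJulia p ×ˢ filledJulia p) ∧
          M = (Q : Matrix (Fin 2) (Fin 2) ℂ) * !![a, 0; 0, b] *
            ((Q⁻¹ : GL (Fin 2) ℂ) : Matrix (Fin 2) (Fin 2) ℂ)} ∪
      {M | ∃ (Q : GL (Fin 2) ℂ) (a : ℂ), a ∈ polyJulia p ∧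
          M = (Q : Matrix (Fin 2) (Fin 2) ℂ) * !![a, 1; 0, a] *
            ((Q⁻¹ : GL (Fin 2) ℂ) : Matrix (Fin 2) (Fin 2) ℂ)} := by
  rw [closure_boundedOrbitSet_matrixPoly p hp, juliaSet_matrixPoly p hp]
  exact ⟨rfl, frontier_spectralFilledJulia p hp⟩
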